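/- All graphs are finite and simple. A detour of a graph $G$ is a longest path of $G$, and the detour covering number $\mathrm{dc}(G)$ is the number of vertices of $G$ that lie in some detour of $G$. A graph is $k$-connected if it has more than $k$ vertices and deleting any fewer than $k$ of its vertices leaves a connected graph. Theorem 8. Let $n > k \ge 0$ be integers. The minimum of $\mathrm{dc}(G)$ over all $k$-connected graphs $G$ of order $n$ is $\min\{n, 3k+2\}$. That is, $\mathrm{dc}(G) \ge \min\{n, 3k+2\}$ for every $k$-connected graph $G$ of order $n$, and equality holds for at least one such graph. Moreover, if $n \ge 3k+2$, then the graph $kK_1 \vee \bigl((k+1)K_2 + (n-3k-2)K_1\bigr)$ is a $k$-connected graph of order $n$ whose detour covering number equals $\min\{n, 3k+2\} = 3k+2$. Here $qH$ denotes the disjoint union of $q$ copies of $H$, $+$ denotes disjoint union, and $G \vee H$ denotes the join, obtained from $G + H$ by adding all edges between $V(G)$ and $V(H)$. -/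

import Mathlib

universe u

namespace SimpleGraph

/-- `p` is a detour: a path of maximum length among all paths of the graph. -/
def Walk.IsDetour {V : Type*} {G : SimpleGraph V} {a b : V} (p : G.Walk a b) : Prop :=
  p.IsPath ∧ ∀ (c d : V) (q : G.Walk c d), q.IsPath → q.length ≤ p.length

/-- The detour covering number: the number of vertices that lie in a detour. -/
noncomputable def detourCoveringNumber {V : Type*} (G : SimpleGraph V) : ℕ :=
  {v : V | ∃ (a b : V) (p : G.Walk a b), p.IsDetour ∧ v ∈ p.support}.ncard

/-- A (finite) graph is `k`-connected if it has more than `k` vertices and deleting any set of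
fewer than `k` vertices leaves a connected graph. -/
def IsKConnected {V : Type*} (G : SimpleGraph V) (k : ℕ) : Prop :=
  k < Nat.card V ∧ ∀ S : Finset V, S.card < k → (G.induce ((S : Set V)ᶜ)).Connected

/-- The join `G ∨ H`: the disjoint union of `G` and `H` together with all edges between them. -/
def graphJoin {V W : Type*} (G : SimpleGraph V) (H : SimpleGraph W) : SimpleGraph (V ⊕ W) :=
  (G ⊕g H) ⊔ completeBipartiteGraph V W

/-- `q G`: the disjoint union of `q` copies of `G`. -/
def copies {V : Type*} (q : ℕ) (G : SimpleGraph V) : SimpleGraph (Fin q × V) where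
  Adj x y := x.1 = y.1 ∧ G.Adj x.2 y.2
  symm.symm _ _ h := ⟨h.1.symm, h.2.symm⟩
  loopless.irrefl x h := G.loopless.irrefl x.2 h.2

/-- The graph `k K₁ ∨ ((k+1) K₂ + (n-3k-2) K₁)`, intended for `3k+2 ≤ n`. -/
def detourExtremal (n k : ℕ) :
    SimpleGraph ((Fin k × Fin 1) ⊕ ((Fin (k + 1) × Fin 2) ⊕ (Fin (n - (3 * k + 2)) × Fin 1))) :=
  graphJoin (copies k (completeGraph (Fin 1)))
    (copies (k + 1) (completeGraph (Fin 2)) ⊕g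
      copies (n - (3 * k + 2)) (completeGraph (Fin 1)))

end SimpleGraph

/-! Lower bound: if every vertex lies in a detour, dc is the order. Otherwise some `z` lies in none;
fix a detour `l` and let C be the component of `z` in G minus `l`. Rerouting `l` through C shows
that vertices of `l` with neighbours in C sit at least two places from either end, and that two of
them less than three apart share a single neighbour in C, which is not `z`. Replacing each attached
vertex by its unique neighbour in C, when it has one other than `z`, yields a set that still
separates `z` from `l` and whose elements come from positions pairwise at least three apart. It has
at least k elements, so `l` has at least 3k+2 vertices (`IsDetourList.le_length_of_notMem`).
Sharpness: complete graphs for n < 3k+2. In the join, a weighted count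
(`IsPathList.length_add_singleCount_le`) keeps the isolated vertices of the second factor off every
detour. -/

namespace SimpleGraph

/-! ### Detours as vertex lists, and path surgery -/

variable {V : Type*} {G : SimpleGraph V}

/-- A list of distinct vertices in which consecutive ones are adjacent. -/
def IsPathList (G : SimpleGraph V) (l : List V) : Prop :=
  l.IsChain G.Adj ∧ l.Nodup

theorem Walk.IsPath.isPathList {a b : V} {p : G.Walk a b} (hp : p.IsPath) :
    G.IsPathList p.support :=
  ⟨p.isChain_adj_support, hp.support_nodup⟩

/-- A path list is a detour list if it is nonempty and no path list is longer. -/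
def IsDetourList (G : SimpleGraph V) (l : List V) : Prop :=
  l ≠ [] ∧ G.IsPathList l ∧ ∀ l', G.IsPathList l' → l'.length ≤ l.length

theorem exists_isDetour_iff (v : V) :
    (∃ (a b : V) (p : G.Walk a b), p.IsDetour ∧ v ∈ p.support) ↔
      ∃ l, G.IsDetourList l ∧ v ∈ l := by
  constructor
  · rintro ⟨a, b, p, ⟨hp, hmax⟩, hv⟩
    refine ⟨p.support, ⟨p.support_ne_nil, hp.isPathList, fun l' hl' => ?_⟩, hv⟩
    rcases eq_or_ne l' [] with rfl | hne
    · simp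
    have := hmax _ _ (Walk.ofSupport l' hne hl'.1)
      ((Walk.isPath_def _).2 (by rw [Walk.support_ofSupport]; exact hl'.2))
    rw [Walk.length_ofSupport] at this
    rw [Walk.length_support]
    omega
  · rintro ⟨l, ⟨hne, hl, hmax⟩, hv⟩
    refine ⟨_, _, Walk.ofSupport l hne hl.1, ⟨(Walk.isPath_def _).2 ?_, fun c d q hq => ?_⟩, ?_⟩
    · rw [Walk.support_ofSupport]; exact hl.2
    · have := hmax _ hq.isPathList
      rw [Walk.length_support] at this
      rw [Walk.length_ofSupport]
      omega
    · rwa [Walk.support_ofSupport]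

theorem detourCoveringNumber_eq :
    G.detourCoveringNumber = {v : V | ∃ l, G.IsDetourList l ∧ v ∈ l}.ncard := by
  unfold detourCoveringNumber
  congr 1
  ext v
  exact exists_isDetour_iff v

theorem IsPathList.singleton (v : V) : G.IsPathList [v] := ⟨.singleton v, List.nodup_singleton v⟩

theorem IsPathList.append {l₁ l₂ : List V} (h₁ : G.IsPathList l₁) (h₂ : G.IsPathList l₂)
    (hadj : ∀ x ∈ l₁.getLast?, ∀ y ∈ l₂.head?, G.Adj x y) (hd : l₁.Disjoint l₂) :
    G.IsPathList (l₁ ++ l₂) :=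
  ⟨List.isChain_append.2 ⟨h₁.1, h₂.1, hadj⟩, h₁.2.append h₂.2 hd⟩

theorem IsPathList.take {l : List V} (h : G.IsPathList l) (i : ℕ) : G.IsPathList (l.take i) :=
  ⟨h.1.take i, h.2.sublist (l.take_sublist i)⟩

theorem IsPathList.drop {l : List V} (h : G.IsPathList l) (i : ℕ) : G.IsPathList (l.drop i) :=
  ⟨h.1.drop i, h.2.sublist (l.drop_sublist i)⟩

theorem IsPathList.append_drop {l q : List V} (hl : G.IsPathList l) (hq : G.IsPathList q)
    (hd : q.Disjoint l) {j : ℕ} {b y : V} (hb : l[j]? = some b) (hy : q.getLast? = some y)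
    (hadj : G.Adj y b) : G.IsPathList (q ++ l.drop j) := by
  refine hq.append (hl.drop j) ?_ fun a ha ha' => hd ha (List.mem_of_mem_drop ha')
  rw [List.head?_drop, hb, hy]
  simpa using hadj

theorem IsPathList.take_append {l q : List V} (hl : G.IsPathList l) (hq : G.IsPathList q)
    (hd : q.Disjoint l) {i : ℕ} {a x : V} (ha : l[i]? = some a) (hx : q.head? = some x)
    (hadj : G.Adj a x) : G.IsPathList (l.take (i + 1) ++ q) := by
  refine (hl.take (i + 1)).append hq ?_ fun a ha ha' => hd ha' (List.mem_of_mem_take ha)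
  rw [hx, List.getLast?_take]
  simpa [ha] using hadj

/-- The detour around the entries strictly between positions `i` and `j`: they are replaced by `q`.
-/
theorem IsPathList.take_append_drop {l q : List V} (hl : G.IsPathList l) (hq : G.IsPathList q)
    (hd : q.Disjoint l) {i j : ℕ} (hij : i < j) {a b x y : V} (ha : l[i]? = some a)
    (hb : l[j]? = some b) (hx : q.head? = some x) (hy : q.getLast? = some y)
    (hax : G.Adj a x) (hyb : G.Adj y b) : G.IsPathList (l.take (i + 1) ++ (q ++ l.drop j)) := by
  refine (hl.take (i + 1)).append (hl.append_drop hq hd hb hy hyb) ?_ ?_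
  · rw [List.head?_append, hx, List.getLast?_take]
    simpa [ha] using hax
  · refine List.disjoint_append_right.2 ⟨fun a ha ha' => hd ha' (List.mem_of_mem_take ha), ?_⟩
    exact List.disjoint_take_drop hl.2 hij

/-- `u` can be reached from `z` without meeting `l`. -/
def ReachableOff (G : SimpleGraph V) (l : List V) (z u : V) : Prop :=
  ∃ p : G.Walk z u, ∀ x ∈ p.support, x ∉ l

theorem ReachableOff.notMem {l : List V} {z u : V} (h : G.ReachableOff l z u) : u ∉ l := by
  obtain ⟨p, hp⟩ := h
  exact hp _ p.end_mem_support

theorem ReachableOff.refl {l : List V} {z : V} (h : z ∉ l) : G.ReachableOff l z z :=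
  ⟨.nil, by simpa using h⟩

theorem ReachableOff.trans_adj {l : List V} {z u w : V} (h : G.ReachableOff l z u)
    (huw : G.Adj u w) (hw : w ∉ l) : G.ReachableOff l z w := by
  obtain ⟨p, hp⟩ := h
  refine ⟨p.concat huw, fun x hx => ?_⟩
  rw [Walk.support_concat, List.mem_append] at hx
  rcases hx with hx | hx
  · exact hp x hx
  · rw [List.mem_singleton.1 hx]; exact hw

theorem ReachableOff.exists_isPathList {l : List V} {z u w : V} (hu : G.ReachableOff l z u)
    (hw : G.ReachableOff l z w) :
    ∃ q, G.IsPathList q ∧ q.Disjoint l ∧ q.head? = some u ∧ q.getLast? = some w := by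
  classical
  obtain ⟨p, hp⟩ := hu
  obtain ⟨p', hp'⟩ := hw
  let q := (p.reverse.append p').bypass
  refine ⟨q.support, (Walk.bypass_isPath _).isPathList, fun x hx => ?_, ?_, ?_⟩
  · have := Walk.support_bypass_subset_support _ hx
    rw [Walk.mem_support_append_iff, Walk.support_reverse, List.mem_reverse] at this
    exact this.elim (hp x) (hp' x)
  · rw [List.head?_eq_some_head q.support_ne_nil, Walk.head_support]
  · rw [List.getLast?_eq_some_getLast q.support_ne_nil, Walk.getLast_support]

/-! ### The lower bound -/

section LowerBound

variable {l : List V} {z : V}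

/-- Replacing the end of `l` beyond the attachment by a path to `z` must shorten `l`, yet that path
has at least one vertex. -/
theorem IsDetourList.two_le_of_attached (hl : G.IsDetourList l)
    (hz : ∀ l', G.IsPathList l' → z ∈ l' → l'.length < l.length) (hzl : z ∉ l)
    {i : ℕ} {a x : V} (ha : l[i]? = some a) (hx : G.ReachableOff l z x) (hax : G.Adj a x) :
    2 ≤ i ∧ i + 3 ≤ l.length := by
  have hi : i < l.length := (List.getElem?_eq_some_iff.1 ha).1
  constructor
  · obtain ⟨q, hq, hd, hh, ht⟩ := (ReachableOff.refl (G := G) hzl).exists_isPathList hx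
    have hzq : z ∈ q := List.mem_of_head? hh
    have := hz _ (hl.2.1.append_drop hq hd ha ht hax.symm) (by simp [hzq])
    have := List.length_pos_of_mem hzq
    simp only [List.length_append, List.length_drop] at *
    omega
  · obtain ⟨q, hq, hd, hh, ht⟩ := hx.exists_isPathList (ReachableOff.refl hzl)
    have hzq : z ∈ q := List.mem_of_getLast? ht
    have := hz _ (hl.2.1.take_append hq hd ha hh hax) (by simp [hzq])
    have := List.length_pos_of_mem hzq
    simp only [List.length_append, List.length_take] at *
    omega

/-- Two attachment positions on a detour at distance less than three are attached, through the
component of `z`, only to a single common vertex other than `z`. -/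
theorem IsDetourList.exists_unique_attachment (hl : G.IsDetourList l)
    (hz : ∀ l', G.IsPathList l' → z ∈ l' → l'.length < l.length)
    {i j : ℕ} {a b x y : V} (hij : i < j) (hji : j < i + 3) (ha : l[i]? = some a)
    (hb : l[j]? = some b) (hx : G.ReachableOff l z x) (hax : G.Adj a x)
    (hy : G.ReachableOff l z y) (hby : G.Adj b y) : x = y ∧ x ≠ z := by
  have hj : j < l.length := (List.getElem?_eq_some_iff.1 hb).1
  obtain ⟨q, hq, hd, hh, ht⟩ := hx.exists_isPathList hy
  have hpath := hl.2.1.take_append_drop hq hd hij ha hb hh ht hax hby.symm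
  have hlen := hl.2.2 _ hpath
  have hxq : x ∈ q := List.mem_of_head? hh
  have hpos := List.length_pos_of_mem hxq
  have hlen' : (l.take (i + 1) ++ (q ++ l.drop j)).length = i + 1 + (q.length + (l.length - j)) := by
    simp only [List.length_append, List.length_drop, List.length_take]
    omega
  -- Fewer than two vertices of `l` are cut out, and maximality of `l` forbids `q` from having more
  -- than that.
  have h1 : q.length = 1 := by omega
  obtain ⟨c, rfl⟩ := List.length_eq_one_iff.1 h1
  simp only [List.head?_cons, Option.some.injEq, List.getLast?_singleton] at hh ht
  refine ⟨hh.symm.trans ht, fun hxz => ?_⟩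
  -- With `q = [z]` the rerouted path would be as long as `l` and contain `z`.
  have := hz _ hpath (by simp [hh, hxz])
  simp only [List.length_singleton] at hlen'
  omega

theorem IsDetourList.le_length_of_notMem [Finite V] {k : ℕ} (hG : G.IsKConnected k)
    (hl : G.IsDetourList l) (hz : ∀ l', G.IsPathList l' → z ∈ l' → l'.length < l.length) :
    3 * k + 2 ≤ l.length := by
  classical
  have := Fintype.ofFinite V
  have hzl : z ∉ l := fun h => (hz l hl.2.1 h).ne rfl
  -- Settles k = 0, where the truncated `l.length - 2` in the final count gives nothing.
  have h2 : 1 < l.length := hz [z] (.singleton z) (by simp)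
  -- `U a x`: `x` is the only neighbour of `a` in the component of `z`, and is not `z`. Then `f`
  -- moves `a` to `x`; otherwise `f` fixes `a`.
  let U : V → V → Prop := fun a x => x ≠ z ∧ G.ReachableOff l z x ∧ G.Adj a x ∧
    ∀ y, G.ReachableOff l z y → G.Adj a y → y = x
  let f : V → V := fun a => if h : ∃ x, U a x then h.choose else a
  have hf : ∀ a x, U a x → f a = x := by
    intro a x hx
    have h : ∃ x, U a x := ⟨x, hx⟩
    have hfa : f a = h.choose := dif_pos h
    rw [hfa]
    exact hx.2.2.2 _ h.choose_spec.2.1 h.choose_spec.2.2.1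
  have hf' : ∀ a, f a = a ∨ U a (f a) := by
    intro a
    by_cases h : ∃ x, U a x
    · right
      have hfa : f a = h.choose := dif_pos h
      rw [hfa]
      exact h.choose_spec
    · exact .inl (dif_neg h)
  let A : Finset V := {a | a ∈ l ∧ ∃ x, G.ReachableOff l z x ∧ G.Adj a x}
  have hA : ∀ a, a ∈ A ↔ a ∈ l ∧ ∃ x, G.ReachableOff l z x ∧ G.Adj a x := by simp [A]
  let S := A.image f
  have hzS : z ∉ S := by
    intro h
    obtain ⟨a, ha, haz⟩ := Finset.mem_image.1 h
    rcases hf' a with h' | h'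
    · rw [← haz, h'] at hzl
      exact hzl ((hA a).1 ha).1
    · exact h'.1 haz
  have h0 : 0 < l.length := by omega
  have h0S : l[0] ∉ S := by
    intro h
    obtain ⟨a, ha, haz⟩ := Finset.mem_image.1 h
    rcases hf' a with h' | h'
    · obtain ⟨x, hx, hax⟩ := ((hA a).1 ha).2
      have := hl.two_le_of_attached hz hzl (i := 0) (a := a)
        (by rw [List.getElem?_eq_getElem h0, ← haz, h']) hx hax
      omega
    · exact h'.2.1.notMem (haz ▸ List.getElem_mem h0)
  have hkS : k ≤ S.card := by
    by_contra! hlt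
    -- A walk avoiding `S` cannot step from the component of `z` onto `l`: the edge used would have
    -- an end in `S`.
    have hinv : ∀ (u w : ((S : Set V)ᶜ : Set V)) (_ : (G.induce ((S : Set V)ᶜ)).Walk u w),
        G.ReachableOff l z u → G.ReachableOff l z w := by
      intro u w p
      induction p with
      | nil => exact id
      | @cons u v w huv p ih =>
        intro hu
        refine ih ?_
        have huv' : G.Adj u v := huv
        by_cases hv : (v : V) ∈ l
        · exfalso
          have hvS : f v ∈ S :=
            Finset.mem_image_of_mem f ((hA v).2 ⟨hv, u, hu, huv'.symm⟩)
          rcases hf' v with h' | h'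
          · exact v.2 (by rw [h'] at hvS; exact hvS)
          · refine u.2 ?_
            rw [h'.2.2.2 u hu huv'.symm]
            exact hvS
        · exact hu.trans_adj huv' hv
    obtain ⟨p⟩ := (hG.2 S hlt).preconnected ⟨z, by simpa using hzS⟩ ⟨l[0], by simpa using h0S⟩
    exact (hinv _ _ p (.refl hzl)).notMem (List.getElem_mem h0)
  have hidx : ∀ s : V, ∃ i : ℕ, s ∈ S → ∃ a x, l[i]? = some a ∧ G.ReachableOff l z x ∧
      G.Adj a x ∧ f a = s := by
    intro s
    by_cases hs : s ∈ S
    · obtain ⟨a, ha, has⟩ := Finset.mem_image.1 hs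
      obtain ⟨hal, x, hx, hax⟩ := (hA a).1 ha
      obtain ⟨i, hi⟩ := List.mem_iff_getElem?.1 hal
      exact ⟨i, fun _ => ⟨a, x, hi, hx, hax, has⟩⟩
    · exact ⟨0, fun h => (hs h).elim⟩
  choose idx hidx using hidx
  have hgap : ∀ s ∈ S, ∀ t ∈ S, s ≠ t → idx s ≤ idx t → idx s + 3 ≤ idx t := by
    intro s hs t ht hst hle
    by_contra! hlt
    obtain ⟨a, x, ha, hx, hax, has⟩ := hidx s hs
    obtain ⟨b, y, hb, hy, hby, hbt⟩ := hidx t ht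
    rcases hle.eq_or_lt with heq | hlt'
    · rw [heq, hb] at ha
      cases ha
      exact hst (has.symm.trans hbt)
    · have key := fun x hx hax y hy hby =>
        hl.exists_unique_attachment (x := x) (y := y) hz hlt' hlt ha hb hx hax hy hby
      obtain ⟨rfl, hxz⟩ := key x hx hax y hy hby
      refine hst ?_
      rw [← has, ← hbt, hf a x ⟨hxz, hx, hax, fun w hw haw => (key w hw haw x hx hby).1⟩,
        hf b x ⟨hxz, hx, hby, fun w hw hbw => (key x hx hax w hw hbw).1.symm⟩]
  have hbd : ∀ s ∈ S, 2 ≤ idx s ∧ idx s + 3 ≤ l.length := by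
    intro s hs
    obtain ⟨a, x, ha, hx, hax, -⟩ := hidx s hs
    exact hl.two_le_of_attached hz hzl ha hx hax
  have hcard : S.card ≤ (Finset.range ((l.length - 2) / 3)).card := by
    -- Cut the positions from 2 on into blocks of three; gaps of three put at most one index in
    -- each.
    refine Finset.card_le_card_of_injOn (fun s => (idx s - 2) / 3) ?_ ?_
    · intro s hs
      have := hbd s hs
      simp only [Finset.coe_range, Set.mem_Iio]
      omega
    · intro s hs t ht hst
      by_contra hne
      have h1 := hbd s hs
      have h2 := hbd t ht
      have h3 := hgap s hs t ht hne
      have h4 := hgap t ht s hs (Ne.symm hne)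
      simp only at hst
      omega
  rw [Finset.card_range] at hcard
  omega

end LowerBound

theorem exists_isDetourList [Finite V] [Nonempty V] : ∃ l, G.IsDetourList l := by
  classical
  have := Fintype.ofFinite V
  obtain ⟨v⟩ := ‹Nonempty V›
  let P : ℕ → Prop := fun m => ∃ l, G.IsPathList l ∧ l.length = m
  have hb : ∀ m, P m → m ≤ Fintype.card V := by
    rintro m ⟨l, hl, rfl⟩
    exact hl.2.length_le_card
  have h1 : P 1 := ⟨[v], .singleton v, rfl⟩
  obtain ⟨l, hl, hlen⟩ := Nat.findGreatest_spec (hb 1 h1) h1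
  have hmax : ∀ l', G.IsPathList l' → l'.length ≤ l.length := fun l' hl' =>
    hlen ▸ Nat.le_findGreatest (hb _ ⟨l', hl', rfl⟩) ⟨l', hl', rfl⟩
  refine ⟨l, ?_, hl, hmax⟩
  rintro rfl
  simpa using hmax [v] (.singleton v)

theorem IsDetourList.length_le_detourCoveringNumber [Finite V] {l : List V}
    (hl : G.IsDetourList l) : l.length ≤ G.detourCoveringNumber := by
  classical
  rw [detourCoveringNumber_eq, ← List.toFinset_card_of_nodup hl.2.1.2, ← Set.ncard_coe_finset]
  exact Set.ncard_le_ncard (fun v hv => ⟨l, hl, by simpa using hv⟩)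

theorem IsKConnected.le_detourCoveringNumber [Finite V] {k : ℕ} (hG : G.IsKConnected k) :
    min (Nat.card V) (3 * k + 2) ≤ G.detourCoveringNumber := by
  have : Nonempty V := (Nat.card_pos_iff.1 (Nat.zero_lt_of_lt hG.1)).1
  obtain ⟨l, hl⟩ := exists_isDetourList (G := G)
  by_cases hall : ∀ v, ∃ l, G.IsDetourList l ∧ v ∈ l
  · refine min_le_iff.2 (.inl ?_)
    rw [detourCoveringNumber_eq, ← Set.ncard_univ]
    exact Set.ncard_le_ncard fun v _ => hall v
  · obtain ⟨z, hz⟩ := not_forall.1 hall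
    refine min_le_iff.2 (.inr ((hl.le_length_of_notMem (z := z) hG ?_).trans
      hl.length_le_detourCoveringNumber))
    intro l' hl' hzl'
    by_contra! hle
    exact hz ⟨l', ⟨List.ne_nil_of_mem hzl', hl', fun l'' hl'' => (hl.2.2 l'' hl'').trans hle⟩, hzl'⟩

theorem detourCoveringNumber_le_card [Finite V] : G.detourCoveringNumber ≤ Nat.card V :=
  Set.ncard_le_card _

end SimpleGraph

namespace SimpleGraph

section Iso

/-! ### Invariance under isomorphism, and complete graphs -/

variable {V W : Type*} {G : SimpleGraph V} {H : SimpleGraph W}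

theorem IsPathList.map (e : G ≃g H) {l : List V} (hl : G.IsPathList l) :
    H.IsPathList (l.map e) :=
  ⟨(List.isChain_map e).2 (hl.1.imp fun _ _ h => e.map_adj_iff.2 h), hl.2.map e.injective⟩

theorem IsDetourList.map (e : G ≃g H) {l : List V} (hl : G.IsDetourList l) :
    H.IsDetourList (l.map e) := by
  refine ⟨by simpa using hl.1, hl.2.1.map e, fun l' hl' => ?_⟩
  simpa using hl.2.2 _ (hl'.map e.symm)

theorem Iso.detourCoveringNumber_le [Finite W] (e : G ≃g H) :
    G.detourCoveringNumber ≤ H.detourCoveringNumber := by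
  rw [detourCoveringNumber_eq, detourCoveringNumber_eq]
  refine Set.ncard_le_ncard_of_injOn e ?_ e.injective.injOn
  rintro v ⟨l, hl, hv⟩
  exact ⟨l.map e, hl.map e, List.mem_map_of_mem hv⟩

theorem Iso.detourCoveringNumber_eq [Finite V] [Finite W] (e : G ≃g H) :
    G.detourCoveringNumber = H.detourCoveringNumber :=
  e.detourCoveringNumber_le.antisymm e.symm.detourCoveringNumber_le

theorem IsKConnected.of_iso {k : ℕ} (hG : G.IsKConnected k) (e : G ≃g H) : H.IsKConnected k := by
  refine ⟨Nat.card_congr e.toEquiv ▸ hG.1, fun S hS => ?_⟩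
  have hconn := hG.2 (S.map e.symm.toEquiv.toEmbedding) (by simpa using hS)
  have hmaps : Set.MapsTo e
      ((S.map e.symm.toEquiv.toEmbedding : Set V)ᶜ) ((S : Set W)ᶜ) := by
    intro v hv hv'
    exact hv (Finset.mem_coe.2 (Finset.mem_map.2 ⟨e v, hv', e.symm_apply_apply v⟩))
  refine hconn.map (induceHom e.toHom hmaps) ?_
  rintro ⟨w, hw⟩
  refine ⟨⟨e.symm w, fun h => hw ?_⟩, Subtype.ext (e.apply_symm_apply w)⟩
  obtain ⟨w', hw', h⟩ := Finset.mem_map.1 (Finset.mem_coe.1 h)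
  rwa [← e.symm.injective h]

end Iso

theorem isKConnected_top {V : Type*} [Finite V] {k : ℕ} (hk : k < Nat.card V) :
    (⊤ : SimpleGraph V).IsKConnected k := by
  classical
  have := Fintype.ofFinite V
  refine ⟨hk, fun S hS => ?_⟩
  have hne : ∃ v, v ∉ S := by
    by_contra! h
    rw [Nat.card_eq_fintype_card, ← Finset.card_univ, ← Finset.eq_univ_of_forall h] at hk
    omega
  obtain ⟨v, hv⟩ := hne
  have : Nonempty ((S : Set V)ᶜ : Set V) := ⟨⟨v, hv⟩⟩
  rw [induce_top]
  exact connected_top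

/-! ### The extremal join -/

section Extremal

/-- The vertex type of `detourExtremal n k`. -/
abbrev ExtremalVertex (n k : ℕ) : Type :=
  (Fin k × Fin 1) ⊕ ((Fin (k + 1) × Fin 2) ⊕ (Fin (n - (3 * k + 2)) × Fin 1))

variable {n k : ℕ}

theorem detourExtremal_adj_inl_inr (x : Fin k × Fin 1)
    (y : (Fin (k + 1) × Fin 2) ⊕ (Fin (n - (3 * k + 2)) × Fin 1)) :
    (detourExtremal n k).Adj (.inl x) (.inr y) := by
  simp [detourExtremal, graphJoin]

theorem detourExtremal_adj_pair_pair {x y : Fin (k + 1) × Fin 2} :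
    (detourExtremal n k).Adj (.inr (.inl x)) (.inr (.inl y)) ↔ x.1 = y.1 ∧ x.2 ≠ y.2 := by
  simp [detourExtremal, graphJoin, copies]

theorem not_detourExtremal_adj_pair_single (x : Fin (k + 1) × Fin 2)
    (y : Fin (n - (3 * k + 2)) × Fin 1) :
    ¬(detourExtremal n k).Adj (.inr (.inl x)) (.inr (.inr y)) := by
  simp [detourExtremal, graphJoin]

theorem not_detourExtremal_adj_single_single (x y : Fin (n - (3 * k + 2)) × Fin 1) :
    ¬(detourExtremal n k).Adj (.inr (.inr x)) (.inr (.inr y)) := by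
  simp [detourExtremal, graphJoin, copies, Subsingleton.elim x.2 y.2]

theorem card_extremalVertex (hn : 3 * k + 2 ≤ n) : Nat.card (ExtremalVertex n k) = n := by
  simp only [Nat.card_eq_fintype_card, Fintype.card_sum, Fintype.card_prod, Fintype.card_fin]
  omega

theorem isKConnected_detourExtremal (hn : 3 * k + 2 ≤ n) :
    (detourExtremal n k).IsKConnected k := by
  classical
  refine ⟨by have := card_extremalVertex hn; unfold ExtremalVertex at this; omega, fun S hS => ?_⟩
  obtain ⟨c, hc⟩ : ∃ c : Fin k × Fin 1, (Sum.inl c : ExtremalVertex n k) ∉ S := by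
    by_contra! h
    have := Finset.card_le_card_of_injOn (s := Finset.univ) (t := S)
      (Sum.inl : _ → ExtremalVertex n k) (fun c _ => h c) Sum.inl_injective.injOn
    simp at this
    omega
  -- Hubs are pairwise nonadjacent, so a surviving pair vertex is needed to link them.
  obtain ⟨d, hd⟩ : ∃ d : Fin (k + 1) × Fin 2, (Sum.inr (.inl d) : ExtremalVertex n k) ∉ S := by
    by_contra! h
    have := Finset.card_le_card_of_injOn (s := Finset.univ) (t := S)
      (fun d => (Sum.inr (.inl d) : ExtremalVertex n k)) (fun c _ => h c)
      (Sum.inr_injective.comp Sum.inl_injective).injOn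
    simp at this
    omega
  rw [connected_iff_exists_forall_reachable]
  let c' : ((S : Set (ExtremalVertex n k))ᶜ : Set (ExtremalVertex n k)) := ⟨.inl c, hc⟩
  have hr : ∀ y (hy : (Sum.inr y : ExtremalVertex n k) ∉ S),
      ((detourExtremal n k).induce ((S : Set (ExtremalVertex n k))ᶜ)).Reachable c'
        ⟨.inr y, hy⟩ := fun y hy => Adj.reachable (detourExtremal_adj_inl_inr c y)
  refine ⟨c', ?_⟩
  rintro ⟨x | y, hy⟩
  · refine (hr _ hd).trans (Adj.reachable ?_)
    exact (detourExtremal_adj_inl_inr x (.inl d)).symm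
  · exact hr y hy

/-- The number of vertices of a list that lie in the `K₁` components of the second factor. -/
def singleCount (l : List (ExtremalVertex n k)) : ℕ :=
  l.countP fun x => x.elim (fun _ => false) Sum.isRight

/-- The number of vertices of a list that lie in the first factor. -/
def hubCount (l : List (ExtremalVertex n k)) : ℕ :=
  (l.filterMap Sum.getLeft?).length

theorem hubCount_le {l : List (ExtremalVertex n k)} (hl : l.Nodup) : hubCount l ≤ k := by
  have h : (l.filterMap Sum.getLeft?).Nodup := by
    refine hl.filterMap ?_
    rintro (a | a) (b | b) c h h' <;> simp_all
  simpa [hubCount] using h.length_le_card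

/-- A path with h hubs has at most h+1 blocks between them, each one `K₁` or part of one `K₂`; with
single vertices counted twice, a block weighs at most 2. The other two clauses strengthen the
induction: the first block may be half a pair, or empty. -/
theorem IsPathList.length_add_singleCount_le {l : List (ExtremalVertex n k)}
    (hl : (detourExtremal n k).IsPathList l) :
    l.length + singleCount l ≤ 3 * hubCount l + 2 ∧
    (∀ i b, l.head? = some (.inr (.inl (i, b))) → (∀ b' ≠ b, .inr (.inl (i, b')) ∉ l) →
      l.length + singleCount l ≤ 3 * hubCount l + 1) ∧
    ((∀ x ∈ l.head?, x.isLeft) → l.length + singleCount l ≤ 3 * hubCount l) := by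
  induction l with
  | nil => simp [singleCount, hubCount]
  | cons x t ih =>
    obtain ⟨hadj, hchain⟩ := List.isChain_cons.1 hl.1
    obtain ⟨hxt, hnodup⟩ := List.nodup_cons.1 hl.2
    obtain ⟨ih1, ih2, ih3⟩ := ih ⟨hchain, hnodup⟩
    rcases x with c | ⟨i, b⟩ | s
    · have e1 : singleCount (Sum.inl c :: t : List (ExtremalVertex n k)) = singleCount t := by
        simp [singleCount]
      have e2 : hubCount (Sum.inl c :: t : List (ExtremalVertex n k)) = hubCount t + 1 := by
        simp [hubCount]
      rw [e1, e2, List.length_cons]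
      exact ⟨by omega, by simp, fun _ => by omega⟩
    · have e1 : singleCount (Sum.inr (Sum.inl (i, b)) :: t : List (ExtremalVertex n k)) =
          singleCount t := by
        simp [singleCount]
      have e2 : hubCount (Sum.inr (Sum.inl (i, b)) :: t : List (ExtremalVertex n k)) =
          hubCount t :=
        congrArg List.length (List.filterMap_cons_none rfl)
      rw [e1, e2, List.length_cons]
      by_cases hh : ∀ x ∈ t.head?, x.isLeft
      · have := ih3 hh
        exact ⟨by omega, fun _ _ _ _ => by omega, by simp⟩
      · rcases t with - | ⟨c | ⟨i', b'⟩ | s, t⟩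
        · simp at hh
        · simp at hh
        · obtain ⟨h1, h2⟩ := detourExtremal_adj_pair_pair.1 (hadj _ rfl)
          simp only at h1 h2
          subst h1
          have := ih2 i b' rfl fun b'' hb'' => by
            have : b'' = b := by omega
            exact this ▸ hxt
          refine ⟨by omega, fun j c hjc hnot => ?_, by simp⟩
          simp only [List.head?_cons, Option.some.injEq, Sum.inr.injEq, Sum.inl.injEq,
            Prod.mk.injEq] at hjc
          obtain ⟨rfl, rfl⟩ := hjc
          exact (hnot b' (Ne.symm h2) (by simp)).elim
        · exact (not_detourExtremal_adj_pair_single _ _ (hadj _ rfl)).elim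
    · have e1 : singleCount (Sum.inr (Sum.inr s) :: t : List (ExtremalVertex n k)) =
          singleCount t + 1 :=
        List.countP_cons_of_pos rfl
      have e2 : hubCount (Sum.inr (Sum.inr s) :: t : List (ExtremalVertex n k)) =
          hubCount t :=
        congrArg List.length (List.filterMap_cons_none rfl)
      rw [e1, e2, List.length_cons]
      have := ih3 (by
        intro y hy
        rcases y with c | p | s'
        · rfl
        · exact (not_detourExtremal_adj_pair_single _ _ (hadj _ hy).symm).elim
        · exact (not_detourExtremal_adj_single_single _ _ (hadj _ hy)).elim)
      exact ⟨by omega, by simp, by simp⟩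

/-- Pairs alternate with hubs. The index bounds keep the next pair and hub unused, and the non-hub
head lets a hub be prepended. -/
theorem exists_isPathList_detourExtremal (j : ℕ) (hj : j ≤ k) :
    ∃ l, (detourExtremal n k).IsPathList l ∧ l.length = 3 * j + 2 ∧
      (∀ x ∈ l.head?, x.isRight) ∧ (∀ c, .inl c ∈ l → c.1.val < j) ∧
      ∀ p, .inr (.inl p) ∈ l → p.1.val ≤ j := by
  have hpair : ∀ i, (detourExtremal n k).IsPathList [.inr (.inl (i, 0)), .inr (.inl (i, 1))] :=
    fun i => ⟨.cons_cons (detourExtremal_adj_pair_pair.2 ⟨rfl, by simp⟩) (.singleton _), by simp⟩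
  induction j with
  | zero => exact ⟨_, hpair 0, by simp, by simp, by simp, by
      intro p hp
      rcases List.mem_pair.1 hp with h | h <;> cases h <;> exact le_rfl⟩
  | succ j ih =>
    obtain ⟨l, hl, hlen, hhead, hhub, hp⟩ := ih (by omega)
    let c : Fin k × Fin 1 := (⟨j, by omega⟩, 0)
    let i : Fin (k + 1) := ⟨j + 1, by omega⟩
    have hcl : (detourExtremal n k).IsPathList (.inl c :: l) := by
      refine (IsPathList.singleton (.inl c)).append hl ?_ ?_
      · intro x hx y hy
        obtain rfl : Sum.inl c = x := by simpa using hx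
        obtain ⟨y, rfl⟩ := Sum.isRight_iff.1 (hhead y hy)
        exact detourExtremal_adj_inl_inr c y
      · rw [List.singleton_disjoint]
        exact fun h => lt_irrefl j (hhub c h)
    refine ⟨[.inr (.inl (i, 0)), .inr (.inl (i, 1))] ++ (.inl c :: l),
      (hpair i).append hcl ?_ ?_, by simp [hlen]; omega, by simp, ?_, ?_⟩
    · intro x hx y hy
      obtain rfl : Sum.inr (Sum.inl (i, 1)) = x := by simpa using hx
      obtain rfl : Sum.inl c = y := by simpa using hy
      exact (detourExtremal_adj_inl_inr c _).symm
    · have hil : ∀ b, .inr (.inl (i, b)) ∉ l := fun b h => by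
        have : j + 1 ≤ j := hp _ h
        omega
      simp [hil]
    · intro d hd
      simp only [List.cons_append, List.nil_append, List.mem_cons, reduceCtorEq, Sum.inl.injEq,
        false_or] at hd
      rcases hd with rfl | hd
      · exact Nat.lt_succ_self j
      · exact (hhub d hd).trans (Nat.lt_succ_self j)
    · intro p hpm
      simp only [List.cons_append, List.nil_append, List.mem_cons, reduceCtorEq, Sum.inr.injEq,
        Sum.inl.injEq, false_or] at hpm
      rcases hpm with rfl | rfl | hpm
      · exact le_rfl
      · exact le_rfl
      · exact (hp p hpm).trans (Nat.le_succ j)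

theorem detourCoveringNumber_detourExtremal_le :
    (detourExtremal n k).detourCoveringNumber ≤ 3 * k + 2 := by
  let f : (Fin k × Fin 1) ⊕ (Fin (k + 1) × Fin 2) → ExtremalVertex n k := Sum.map id Sum.inl
  have hsub : {v | ∃ l, (detourExtremal n k).IsDetourList l ∧ v ∈ l} ⊆ Set.range f := by
    rintro (c | p | s) ⟨l, hl, hv⟩
    · exact ⟨.inl c, rfl⟩
    · exact ⟨.inr p, rfl⟩
    · exfalso
      obtain ⟨l', hl', hlen, -⟩ := exists_isPathList_detourExtremal (n := n) k le_rfl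
      have h1 := hl.2.2 l' hl'
      have h2 := hl.2.1.length_add_singleCount_le.1
      have h3 := hubCount_le hl.2.1.2
      -- A single vertex costs one unit of the bound 3k+2, leaving `l` shorter than `l'`.
      have h4 : 0 < singleCount l := List.countP_pos_iff.2 ⟨_, hv, rfl⟩
      omega
  rw [detourCoveringNumber_eq]
  refine (Set.ncard_le_ncard hsub).trans ?_
  rw [← Set.image_univ]
  refine (Set.ncard_image_le).trans ?_
  rw [Set.ncard_univ, Nat.card_eq_fintype_card]
  simp only [Fintype.card_sum, Fintype.card_prod, Fintype.card_fin]
  omega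

theorem detourCoveringNumber_detourExtremal (hn : 3 * k + 2 ≤ n) :
    (detourExtremal n k).detourCoveringNumber = min n (3 * k + 2) := by
  refine le_antisymm ?_ ?_
  · rw [min_eq_right hn]
    exact detourCoveringNumber_detourExtremal_le
  · have := (isKConnected_detourExtremal hn).le_detourCoveringNumber
    rwa [show Nat.card _ = n from card_extremalVertex hn] at this

end Extremal

end SimpleGraph

open SimpleGraph in
theorem theorem8 (n k : ℕ) (hkn : k < n) :
    IsLeast
      {d : ℕ | ∃ (V : Type u) (_ : Finite V) (G : SimpleGraph V),
        Nat.card V = n ∧ G.IsKConnected k ∧ G.detourCoveringNumber = d}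
      (min n (3 * k + 2)) ∧
    (3 * k + 2 ≤ n →
      Nat.card ((Fin k × Fin 1) ⊕
        ((Fin (k + 1) × Fin 2) ⊕ (Fin (n - (3 * k + 2)) × Fin 1))) = n ∧
      (SimpleGraph.detourExtremal n k).IsKConnected k ∧
      (SimpleGraph.detourExtremal n k).detourCoveringNumber = min n (3 * k + 2)) := by
  refine ⟨⟨?_, ?_⟩, fun hn => ⟨card_extremalVertex hn, isKConnected_detourExtremal hn,
    detourCoveringNumber_detourExtremal hn⟩⟩
  · rcases le_or_gt (3 * k + 2) n with hn | hn
    -- The minimum ranges over graphs in `Type u`, so the example is lifted there.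
    · let e : (detourExtremal n k).comap Equiv.ulift.{u} ≃g detourExtremal n k :=
        Iso.comap Equiv.ulift _
      refine ⟨ULift.{u} (ExtremalVertex n k), inferInstance, _, ?_,
        (isKConnected_detourExtremal hn).of_iso e.symm, ?_⟩
      · rw [Nat.card_congr Equiv.ulift, card_extremalVertex hn]
      · rw [e.detourCoveringNumber_eq, detourCoveringNumber_detourExtremal hn]
    · have hcard : Nat.card (ULift.{u} (Fin n)) = n := by simp
      have hconn : (⊤ : SimpleGraph (ULift.{u} (Fin n))).IsKConnected k :=
        isKConnected_top (by rwa [hcard])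
      refine ⟨ULift.{u} (Fin n), inferInstance, ⊤, hcard, hconn, le_antisymm ?_ ?_⟩
      · rw [min_eq_left hn.le]
        exact detourCoveringNumber_le_card.trans hcard.le
      · have := hconn.le_detourCoveringNumber
        rwa [hcard] at this
  · rintro d ⟨V, _, G, hV, hG, rfl⟩
    rw [← hV]
    exact hG.le_detourCoveringNumber
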